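/- **Setting.** Let $\mathcal S^d$ be the space of real symmetric $d\times d$ matrices and $\mathcal S_{++}^d\subset\mathcal S^d$ the manifold of symmetric positive definite (SPD) matrices. For $X\in\mathcal S_{++}^d$ and $S,T\in\mathcal S^d$ put $g^{BW}_X(S,T)=\frac12\operatorname{tr}(L\,T)$, where $L\in\mathcal S^d$ solves $XL+LX=S$. For $M\in\mathcal S_{++}^d$ put $g^{GBW}_X(S,T)=\frac12\operatorname{tr}(L'\,T)$, where $L'\in\mathcal S^d$ solves $XL'M+ML'X=S$. For $\theta\in\mathbb R\setminus\{0\}$ let $\phi_\theta(X)=X^\theta$ and $$g^{(\theta)}_X(S,T)=\tfrac1{\theta^2}\,g^{GBW}_{X^\theta}\big((\phi_\theta)_{*,X}S,(\phi_\theta)_{*,X}T\big),$$ the power-deformed GBW metric. For a Riemannian metric $g$ on $\mathcal S_{++}^d$ let $\mathrm{Exp},\mathrm{Log},\Gamma,d_g$ be its (partially defined) Riemannian exponential, logarithm, parallel transport along the geodesic joining two points, and distance. A weighted Fréchet mean of $X_1,\dots,X_N$ with weights $w_i\ge0$, $\sum_i w_i=1$, is a minimizer over $\mathcal S_{++}^d$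 of $G\mapsto\sum_i w_i d_g^2(G,X_i)$; the case $w_i=\frac1N$ is a Fréchet mean. For a point $B$ put $\nu_g^2(B;X_1,\dots,X_N)=\frac1N\sum_i d_g^2(B,X_i)$, which is the Fréchet variance when $B$ is the Fréchet mean. Riemannian batch normalization (RBN) for $g$, with reference point $R$, bias $\mathcal G\in\mathcal S^d_{++}$, $\epsilon>0$, $s\neq0$ and variance factor $\kappa>0$, maps a point $X$, given a mean $B$ and a variance $\nu^2$, to $\tilde X$, where $$\bar X=\mathrm{Exp}_{R}\big(\Gamma_{B\to R}\mathrm{Log}_{B}X\big),\quad \check X=\mathrm{Exp}_{R}\Big(\tfrac{s}{\sqrt{\nu^2+\epsilon}}\mathrm{Log}_{R}\bar X\Big),\quad \tilde X=\mathrm{Exp}_{\mathcal G}\big(\Gamma_{R\to\mathcal G}\mathrm{Log}_{R}\check X\big).$$ In training, $B=B_b$ is the Fréchet mean of the batch and $\nu^2=\nu_b^2:=\kappa\,\nu_g^2(B_b;X_1,\dots,X_N)$, and the running statistics $(B_r,\nu_r^2)$, with $B_r\in\mathcal S_{++}^d$ and $\nu_r^2\ge 0$, are replaced by (the Fréchet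 mean of $B_r,B_b$ with weights $(1-\omega,\omega)$, $\ (1-\omega)\nu_r^2+\omega\nu_b^2$) for a momentum $\omega\in[0,1]$. In testing, $B=B_r$ and $\nu^2=\nu_r^2$. Everything is undefined whenever one of its ingredients is not defined or (for means) not unique. BWBN is RBN for $g^{BW}$ with reference point $I_d$. **Theorem.** Let $d\in\mathbb N$, $\theta\ne0$, $M\in\mathcal S_{++}^d$, $\varphi(X)=M^{1/2}XM^{1/2}$ and $$f=\phi_\theta^{-1}\circ\varphi:\ X\mapsto\big(M^{1/2}XM^{1/2}\big)^{1/\theta},\qquad f^{-1}(Y)=M^{-1/2}Y^\theta M^{-1/2}.$$ 1. $f$ is a smooth diffeomorphism of $\mathcal S_{++}^d$ with the smooth inverse $f^{-1}$ displayed above, and a Riemannian isometry from $(\mathcal S_{++}^d,g^{BW})$ onto $(\mathcal S_{++}^d,\theta^2 g^{(\theta)})$. 2. For every $N$-tuple of SPD matrices $X_i$ and all such weights, the set of weighted Fréchet means of $\{X_i\}$ for $g^{(\theta)}$ is the image under $f$ of the set of weighted Fréchet means of $\{f^{-1}(X_i)\}$ for $g^{BW}$. Moreover, for every SPD matrix $B$,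 $\nu^2_{g^{(\theta)}}(B;\{X_i\})=\frac1{\theta^2}\,\nu^2_{g^{BW}}(f^{-1}(B);\{f^{-1}(X_i)\})$. 3. Let $c>0$, let $X_1,\dots,X_N$, $\mathcal G$, $R$ be SPD matrices, and let $\epsilon,s,\omega,(B_r,\nu_r^2)$ be as above. RBN for $c\,g^{(\theta)}$ (with variance factor $1$, bias $\mathcal G$, reference point $f(R)$) is obtained by mapping data, bias and running mean by $f^{-1}$, running RBN for $g^{BW}$ with reference point $R$ and variance factor $c/\theta^2$ (all other parameters unchanged), and mapping the result back by $f$. This holds for every sample's output in training, for its output in testing, and for the update of the running statistics; in each case one side is defined if and only if the other is, and then they agree. In particular, take $R=I_d$, so that $f(R)=M^{1/\theta}$. For $c=1$, RBN under the power-deformed GBW metric equals $f\circ\mathrm{BWBN}\circ f^{-1}$, where the batch variance in BWBN is divided by $\theta^2$; for $c=\theta^2$ it equals $f\circ\mathrm{BWBN}\circ f^{-1}$ with the unmodified BWBN. -/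

import Mathlib

open scoped ContDiff

attribute [local instance] Matrix.frobeniusNormedAddCommGroup Matrix.frobeniusNormedSpace

noncomputable section

/-! Riemannian geometry of a metric tensor on an open subset of a normed space (one global chart). -/

namespace RiemChart

variable {E : Type*} [NormedAddCommGroup E] [NormedSpace ℝ E]

/-- `∂ᵤ g (v, w)` at `x`: the derivative of `y ↦ g y v w` at `x` in the direction `u`. -/
def metricDeriv (g : E → E → E → ℝ) (x u v w : E) : ℝ :=
  fderiv ℝ (fun y => g y v w) x u

/-- Christoffel symbol of the first kind of the Levi-Civita connection (Koszul formula for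
constant vector fields): `⟨∇ᵤ v, w⟩ = ½ (∂ᵤ⟨v, w⟩ + ∂ᵥ⟨u, w⟩ - ∂_w⟨u, v⟩)`. -/
def christoffel (g : E → E → E → ℝ) (x u v w : E) : ℝ :=
  (metricDeriv g x u v w + metricDeriv g x v u w - metricDeriv g x w u v) / 2

/-- Velocity of a curve parametrised by `[0, 1]`. -/
def velocity (γ : ℝ → E) (t : ℝ) : E := derivWithin γ (Set.Icc 0 1) t

/-- `V` is a parallel vector field along the curve `γ : [0, 1] → U`, i.e. `D V / dt = 0`; as `g` is
nondegenerate this is expressed by pairing the covariant derivative with every vector `w`. -/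
def IsParallelAlong (g : E → E → E → ℝ) (γ V : ℝ → E) : Prop :=
  ContDiffOn ℝ 1 V (Set.Icc 0 1) ∧
    ∀ t ∈ Set.Icc (0 : ℝ) 1, ∀ w : E,
      g (γ t) (velocity V t) w + christoffel g (γ t) (velocity γ t) (V t) w = 0

/-- `γ : [0, 1] → U` is a geodesic of `(U, g)`: its velocity is parallel along it. -/
def IsGeodesic (U : Set E) (g : E → E → E → ℝ) (γ : ℝ → E) : Prop :=
  ContDiffOn ℝ 2 γ (Set.Icc 0 1) ∧ (∀ t ∈ Set.Icc (0 : ℝ) 1, γ t ∈ U) ∧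
    IsParallelAlong g γ (velocity γ)

/-- The geodesic of `(U, g)` from `x` with initial velocity `v` exists on `[0, 1]`, ends at `y`. -/
def ExpRel (U : Set E) (g : E → E → E → ℝ) (x v y : E) : Prop :=
  ∃ γ : ℝ → E, IsGeodesic U g γ ∧ γ 0 = x ∧ velocity γ 0 = v ∧ γ 1 = y

/-- The partially defined value singled out by a predicate: defined exactly when precisely one
element satisfies it. -/
def uniqueVal {α : Type*} (P : α → Prop) : Part α := ⟨∃! a, P a, fun h => Classical.choose h⟩

/-- Riemannian exponential map `Exp_x v` (partially defined: `(U, g)` need not be complete). -/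
def riemExp (U : Set E) (g : E → E → E → ℝ) (x v : E) : Part E :=
  uniqueVal fun y => ExpRel U g x v y

/-- Riemannian logarithm `Log_x y`: the tangent vector at `x` with `Exp_x v = y`. -/
def riemLog (U : Set E) (g : E → E → E → ℝ) (x y : E) : Part E :=
  uniqueVal fun v => ExpRel U g x v y

/-- Parallel transport `Γ_{x → y} v` along the geodesic from `x` to `y`. -/
def parTransport (U : Set E) (g : E → E → E → ℝ) (x y v : E) : Part E :=
  uniqueVal fun w => ∃ γ V : ℝ → E, IsGeodesic U g γ ∧ γ 0 = x ∧ γ 1 = y ∧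
    IsParallelAlong g γ V ∧ V 0 = v ∧ V 1 = w

/-- Riemannian length of a curve. -/
def curveLength (g : E → E → E → ℝ) (γ : ℝ → E) : ℝ :=
  ∫ t in (0 : ℝ)..1, Real.sqrt (g (γ t) (velocity γ t) (velocity γ t))

/-- Riemannian distance: infimum of the lengths of the `C¹` curves in `U` joining the points. -/
def riemDist (U : Set E) (g : E → E → E → ℝ) (x y : E) : ℝ :=
  sInf {l : ℝ | ∃ γ : ℝ → E, ContDiffOn ℝ 1 γ (Set.Icc 0 1) ∧
    (∀ t ∈ Set.Icc (0 : ℝ) 1, γ t ∈ U) ∧ γ 0 = x ∧ γ 1 = y ∧ curveLength g γ = l}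

/-- The set of weighted Fréchet means of `X₁, …, X_N` (minimisers of `∑ wᵢ d²(·, Xᵢ)` on `U`). -/
def frechetMeans (U : Set E) (g : E → E → E → ℝ) {N : ℕ} (w : Fin N → ℝ) (X : Fin N → E) :
    Set E :=
  {B | B ∈ U ∧ ∀ Y ∈ U, ∑ i, w i * riemDist U g B (X i) ^ 2 ≤ ∑ i, w i * riemDist U g Y (X i) ^ 2}

/-- The weighted Fréchet mean, defined when it exists and is unique. -/
def wfm (U : Set E) (g : E → E → E → ℝ) {N : ℕ} (w : Fin N → ℝ) (X : Fin N → E) : Part E :=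
  uniqueVal fun B => B ∈ frechetMeans U g w X

/-- The mean squared distance `(1/N) ∑ d²(B, Xᵢ)`; for `B` the Fréchet mean of the batch, this is
the Fréchet variance. -/
def frechetVar (U : Set E) (g : E → E → E → ℝ) {N : ℕ} (B : E) (X : Fin N → E) : ℝ :=
  (1 / (N : ℝ)) * ∑ i, riemDist U g B (X i) ^ 2

/-- `p ↦ Exp_y (Γ_{x → y} (Log_x p))`. -/
def shift (U : Set E) (g : E → E → E → ℝ) (x y p : E) : Part E :=
  (riemLog U g x p).bind fun v => (parTransport U g x y v).bind fun w => riemExp U g y w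

/-- `p ↦ Exp_R (c Log_R p)`. -/
def rescale (U : Set E) (g : E → E → E → ℝ) (R : E) (c : ℝ) (p : E) : Part E :=
  (riemLog U g R p).bind fun v => riemExp U g R (c • v)

/-- Normalisation of a point with given statistics `B`, `ν²`: centering from the mean `B` to the
reference point `R`, scaling at `R` by `s / √(ν² + ε)`, biasing from `R` to `G`. -/
def normalize (U : Set E) (g : E → E → E → ℝ) (R : E) (ε s : ℝ) (G B : E) (var : ℝ) (p : E) :
    Part E :=
  (shift U g B R p).bind fun q =>
    (rescale U g R (s / Real.sqrt (var + ε)) q).bind fun q' => shift U g R G q'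

/-- Running statistics of a batch normalisation layer. -/
structure RunStats (E : Type*) where
  /-- running mean `B_r` -/
  mean : E
  /-- running variance `ν_r²` -/
  var : ℝ

/-- Transport of running statistics along a map: the mean is mapped, the variance unchanged. -/
def RunStats.map {E F : Type*} (f : E → F) (σ : RunStats E) : RunStats F := ⟨f σ.mean, σ.var⟩

/-- Riemannian batch normalisation in the training phase: output for the `i`-th sample. The batch
statistics are the Fréchet mean and `κ` times the Fréchet variance (`κ = 1` is the plain version). -/
def rbnTrain (U : Set E) (g : E → E → E → ℝ) (κ : ℝ) (R : E) (ε s : ℝ) (G : E) {N : ℕ}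
    (X : Fin N → E) (i : Fin N) : Part E :=
  (wfm U g (fun _ => 1 / (N : ℝ)) X).bind fun B =>
    normalize U g R ε s G B (κ * frechetVar U g B X) (X i)

/-- Update of the running statistics in the training phase, with momentum `m`:
`B_r ← E₂^{(1-m, m)}(B_r, B_b)` and `ν_r² ← (1-m) ν_r² + m ν_b²`. -/
def rbnUpdate (U : Set E) (g : E → E → E → ℝ) (κ m : ℝ) {N : ℕ} (X : Fin N → E)
    (σ : RunStats E) : Part (RunStats E) :=
  (wfm U g (fun _ => 1 / (N : ℝ)) X).bind fun B =>
    (wfm U g ![1 - m, m] ![σ.mean, B]).map fun B' =>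
      ⟨B', (1 - m) * σ.var + m * (κ * frechetVar U g B X)⟩

/-- Riemannian batch normalisation in the testing phase: the running statistics are used. -/
def rbnTest (U : Set E) (g : E → E → E → ℝ) (R : E) (ε s : ℝ) (G : E) (σ : RunStats E) (p : E) :
    Part E :=
  normalize U g R ε s G σ.mean σ.var p

/-- `f` is a Riemannian isometry from `(U, g)` onto `(V, h)` with inverse `finv`: a smooth
diffeomorphism of `U` onto `V` with `f^* h = g`. -/
structure IsRiemIsometry {F : Type*} [NormedAddCommGroup F] [NormedSpace ℝ F]
    (U : Set E) (g : E → E → E → ℝ) (V : Set F) (h : F → F → F → ℝ)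
    (f : E → F) (finv : F → E) : Prop where
  mapsTo : Set.MapsTo f U V
  mapsTo_inv : Set.MapsTo finv V U
  invOn : Set.InvOn finv f U V
  smooth : ContDiffOn ℝ ∞ f U
  smooth_inv : ContDiffOn ℝ ∞ finv V
  isometry : ∀ x ∈ U, ∀ u v : E, h (f x) (fderiv ℝ f x u) (fderiv ℝ f x v) = g x u v

end RiemChart

/-! Bures-Wasserstein geometries on symmetric positive definite matrices. -/

namespace SPD

/-- The normed space of real symmetric `d × d` matrices. -/
abbrev Sym (d : ℕ) : Type := selfAdjoint.submodule ℝ (Matrix (Fin d) (Fin d) ℝ)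

/-- The manifold `S_{++}^d`, an open subset of the symmetric matrices. -/
def spd (d : ℕ) : Set (Sym d) := {X | (X : Matrix (Fin d) (Fin d) ℝ).PosDef}

variable {d : ℕ}

theorem Sym.isHermitian (X : Sym d) : (X : Matrix (Fin d) (Fin d) ℝ).IsHermitian := X.2

/-- The real matrix power `φ_a(X) = X^a` (through the eigenvalues); meaningful on `spd d`. -/
def power (a : ℝ) (X : Sym d) : Sym d :=
  ⟨X.isHermitian.cfc fun x => x ^ a, by
    rw [← X.isHermitian.cfc_eq]; exact cfc_predicate _ _⟩

/-- The congruence `X ↦ A X A` by a symmetric matrix `A`. -/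
def congr (A X : Sym d) : Sym d :=
  ⟨(A : Matrix (Fin d) (Fin d) ℝ) * X * A, by
    have hA : star (A : Matrix (Fin d) (Fin d) ℝ) = A := A.2
    have hX : star (X : Matrix (Fin d) (Fin d) ℝ) = X := X.2
    show star _ = _
    rw [star_mul, star_mul, hA, hX, mul_assoc]⟩

/-- Lyapunov operator: the solution `L` of `X L + L X = S` (unique for `X` in `spd d`). -/
def lyapunov (X S : Sym d) : Sym d :=
  Classical.epsilon fun L : Sym d =>
    (X : Matrix (Fin d) (Fin d) ℝ) * L + (L : Matrix (Fin d) (Fin d) ℝ) * X = S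

/-- Generalised Lyapunov operator: the solution `L` of `X L M + M L X = S` (unique for `X`, `M` in
`spd d`). -/
def genLyapunov (M X S : Sym d) : Sym d :=
  Classical.epsilon fun L : Sym d =>
    (X : Matrix (Fin d) (Fin d) ℝ) * L * M + (M : Matrix (Fin d) (Fin d) ℝ) * L * X = S

/-- Bures-Wasserstein metric. -/
def bwMetric (X S T : Sym d) : ℝ :=
  (1 / 2) * ((lyapunov X S : Matrix (Fin d) (Fin d) ℝ) * T).trace

/-- Generalised Bures-Wasserstein metric with parameter `M`. -/
def gbwMetric (M X S T : Sym d) : ℝ :=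
  (1 / 2) * ((genLyapunov M X S : Matrix (Fin d) (Fin d) ℝ) * T).trace

/-- Power-deformed generalised Bures-Wasserstein metric: `θ⁻²` times the pullback of the
generalised metric by `φ_θ`. -/
def powGbwMetric (θ : ℝ) (M X S T : Sym d) : ℝ :=
  (1 / θ ^ 2) * gbwMetric M (power θ X) (fderiv ℝ (power θ) X S) (fderiv ℝ (power θ) X T)

/-- `f(X) = (M^{1/2} X M^{1/2})^{1/θ}`. -/
def fMap (θ : ℝ) (M X : Sym d) : Sym d := power (1 / θ) (congr (power (1 / 2) M) X)

/-- `f⁻¹(Y) = M^{-1/2} Y^θ M^{-1/2}`. -/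
def fInv (θ : ℝ) (M Y : Sym d) : Sym d := congr (power (-(1 / 2)) M) (power θ Y)

end SPD

end

namespace RiemChart

set_option maxSynthPendingDepth 3

/-! Every ingredient of RBN is natural under isometries, so it suffices to see that `f` is one and
to follow a constant factor of the metric. On the SPD matrices `φ_θ ∘ f` is the congruence by `A =
M^{1/2}`, so by the chain rule `f` pulls `θ² g^{(θ)}` back to the pullback of GBW by that
congruence. This is BW: `L'` solves the generalised Lyapunov equation at `AXA` with right side `ASA`
iff `L = A L' A` solves `XL + LX = S`, and `tr(L' ATA) = tr(LT)` (`gbwMetric_congr`,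
`fderiv_power_fMap`). Naturality of geodesics and parallel transport rests on the transformation law
of Christoffel symbols (`christoffel_eq`, `isParallelAlong_iff`), which needs a differentiable
metric on the target only. The isometry is therefore used as `f⁻¹`, from `c g^{(θ)}` to `(c/θ²)
g^{BW}`: only BW has to be shown differentiable, via invertibility of the Lyapunov operator. A
positive constant in the metric changes neither geodesics nor transport, but multiplies squared
distances. Fréchet means stay, and the constant moves into the variance factor. Partiality is
handled by equalities in `Part`, which include equivalence of definedness (`uniqueVal_eq_map`).
Smoothness of matrix powers comes from the binomial series about multiples of the identity. -/

theorem mem_uniqueVal {α : Type*} {P : α → Prop} {a : α} :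
    a ∈ uniqueVal P ↔ P a ∧ ∀ b, P b → b = a := by
  constructor
  · rintro ⟨h, rfl⟩
    exact Classical.choose_spec h
  · intro h
    have h' : ∃! a, P a := ⟨a, h⟩
    exact ⟨h', h.2 _ (Classical.choose_spec h').1⟩

/-- Values singled out by corresponding predicates correspond. -/
theorem uniqueVal_eq_map {α β : Type*} {P : α → Prop} {Q : β → Prop} (i : β → α) (j : α → β)
    (hP : ∀ a, P a → Q (j a) ∧ i (j a) = a) (hQ : ∀ b, Q b → P (i b) ∧ j (i b) = b) :
    uniqueVal P = (uniqueVal Q).map i := by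
  ext a
  rw [Part.mem_map_iff]
  constructor
  · intro h
    rw [mem_uniqueVal] at h
    refine ⟨j a, mem_uniqueVal.2 ⟨(hP a h.1).1, fun b hb => ?_⟩, (hP a h.1).2⟩
    rw [← (hQ b hb).2, h.2 _ (hQ b hb).1]
  · rintro ⟨b, hb, rfl⟩
    rw [mem_uniqueVal] at hb ⊢
    refine ⟨(hQ b hb.1).1, fun a ha => ?_⟩
    rw [← (hP a ha).2, hb.2 _ (hP a ha).1]

/-- The inverse identities of an isometry hold only on the manifold; this lets later stages use that
earlier outputs lie there. -/
theorem bind_congr_of_mem {α β : Type*} {p : Part α} {f g : α → Part β}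
    (h : ∀ a ∈ p, f a = g a) : p.bind f = p.bind g := by
  ext b
  simp only [Part.mem_bind_iff]
  exact exists_congr fun a => and_congr_right fun ha => by rw [h a ha]

variable {E F : Type*} [NormedAddCommGroup E] [NormedSpace ℝ E]
  [NormedAddCommGroup F] [NormedSpace ℝ F]

/-! ### Curves -/

theorem uniqueDiffWithinAt_unitInterval {t : ℝ} (ht : t ∈ Set.Icc (0 : ℝ) 1) :
    UniqueDiffWithinAt ℝ (Set.Icc (0 : ℝ) 1) t :=
  uniqueDiffOn_Icc zero_lt_one t ht

theorem zero_mem_unitInterval : (0 : ℝ) ∈ Set.Icc (0 : ℝ) 1 := ⟨le_rfl, zero_le_one⟩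

theorem one_mem_unitInterval : (1 : ℝ) ∈ Set.Icc (0 : ℝ) 1 := ⟨zero_le_one, le_rfl⟩

theorem velocity_congr {γ η : ℝ → E} (h : Set.EqOn γ η (Set.Icc 0 1)) {t : ℝ}
    (ht : t ∈ Set.Icc (0 : ℝ) 1) : velocity γ t = velocity η t :=
  derivWithin_congr h (h ht)

theorem hasDerivWithinAt_velocity {γ : ℝ → E} (h : ContDiffOn ℝ 1 γ (Set.Icc 0 1)) {t : ℝ}
    (ht : t ∈ Set.Icc (0 : ℝ) 1) : HasDerivWithinAt γ (velocity γ t) (Set.Icc 0 1) t :=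
  ((h.differentiableOn one_ne_zero) t ht).hasDerivWithinAt

/-- Curves are functions on all of `ℝ`, but only their values on `[0, 1]` matter. This is needed
because `φ ∘ ψ ∘ η` agrees with `η` only there. -/
theorem IsParallelAlong.congr {g : E → E → E → ℝ} {γ η V W : ℝ → E}
    (h : IsParallelAlong g γ V) (hγ : Set.EqOn η γ (Set.Icc 0 1))
    (hV : Set.EqOn W V (Set.Icc 0 1)) : IsParallelAlong g η W := by
  refine ⟨h.1.congr hV, fun t ht w => ?_⟩
  rw [velocity_congr hV ht, velocity_congr hγ ht, hγ ht, hV ht]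
  exact h.2 t ht w

theorem IsGeodesic.congr {U : Set E} {g : E → E → E → ℝ} {γ η : ℝ → E}
    (h : IsGeodesic U g γ) (hγ : Set.EqOn η γ (Set.Icc 0 1)) : IsGeodesic U g η :=
  ⟨h.1.congr hγ, fun t ht => hγ ht ▸ h.2.1 t ht,
    h.2.2.congr hγ fun _ ht => velocity_congr hγ ht⟩

theorem velocity_comp {φ : E → F} {γ : ℝ → E} (hγ : ContDiffOn ℝ 1 γ (Set.Icc 0 1)) {t : ℝ}
    (ht : t ∈ Set.Icc (0 : ℝ) 1) (hφ : DifferentiableAt ℝ φ (γ t)) :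
    velocity (φ ∘ γ) t = fderiv ℝ φ (γ t) (velocity γ t) :=
  (hφ.hasFDerivAt.comp_hasDerivWithinAt t (hasDerivWithinAt_velocity hγ ht)).derivWithin
    (uniqueDiffWithinAt_unitInterval ht)

theorem velocity_clm_apply {A : E → E →L[ℝ] F} {γ W : ℝ → E}
    (hγ : ContDiffOn ℝ 1 γ (Set.Icc 0 1)) (hW : ContDiffOn ℝ 1 W (Set.Icc 0 1)) {t : ℝ}
    (ht : t ∈ Set.Icc (0 : ℝ) 1) (hA : DifferentiableAt ℝ A (γ t)) :
    velocity (fun t => A (γ t) (W t)) t =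
      fderiv ℝ A (γ t) (velocity γ t) (W t) + A (γ t) (velocity W t) :=
  ((hA.hasFDerivAt.comp_hasDerivWithinAt t (hasDerivWithinAt_velocity hγ ht)).clm_apply
    (hasDerivWithinAt_velocity hW ht)).derivWithin (uniqueDiffWithinAt_unitInterval ht)

/-! ### Isometries -/

/-- `g` is symmetric and given on `U` by a differentiable field of continuous bilinear forms. -/
structure IsDiffMetric (U : Set E) (g : E → E → E → ℝ) : Prop where
  exists_form : ∃ G : E → E →L[ℝ] E →L[ℝ] ℝ, (∀ x ∈ U, DifferentiableAt ℝ G x) ∧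
    ∀ x ∈ U, ∀ u v, g x u v = G x u v
  symm : ∀ x ∈ U, ∀ u v, g x u v = g x v u

variable {U : Set E} {g : E → E → E → ℝ} {V : Set F} {h : F → F → F → ℝ} {φ : E → F} {ψ : F → E}

namespace IsRiemIsometry

theorem contDiffAt (hf : IsRiemIsometry U g V h φ ψ) (hU : IsOpen U) {x : E} (hx : x ∈ U) :
    ContDiffAt ℝ ∞ φ x :=
  hf.smooth.contDiffAt (hU.mem_nhds hx)

theorem differentiableAt (hf : IsRiemIsometry U g V h φ ψ) (hU : IsOpen U) {x : E} (hx : x ∈ U) :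
    DifferentiableAt ℝ φ x :=
  (hf.contDiffAt hU hx).differentiableAt (by simp)

theorem differentiableAt_inv (hf : IsRiemIsometry U g V h φ ψ) (hV : IsOpen V) {y : F}
    (hy : y ∈ V) : DifferentiableAt ℝ ψ y :=
  (hf.smooth_inv.contDiffAt (hV.mem_nhds hy)).differentiableAt (by simp)

theorem fderiv_inv_apply (hf : IsRiemIsometry U g V h φ ψ) (hU : IsOpen U) (hV : IsOpen V) {x : E}
    (hx : x ∈ U) (v : E) : fderiv ℝ ψ (φ x) (fderiv ℝ φ x v) = v := by
  have h1 : HasFDerivAt (ψ ∘ φ) ((fderiv ℝ ψ (φ x)).comp (fderiv ℝ φ x)) x :=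
    (hf.differentiableAt_inv hV (hf.mapsTo hx)).hasFDerivAt.comp x
      (hf.differentiableAt hU hx).hasFDerivAt
  have h2 : HasFDerivAt (ψ ∘ φ) (ContinuousLinearMap.id ℝ E) x := by
    refine (hasFDerivAt_id x).congr_of_eventuallyEq ?_
    filter_upwards [hU.mem_nhds hx] with y hy using hf.invOn.1 hy
  exact DFunLike.congr_fun (h1.unique h2) v

theorem fderiv_apply_inv (hf : IsRiemIsometry U g V h φ ψ) (hU : IsOpen U) (hV : IsOpen V) {x : E}
    (hx : x ∈ U) (w : F) : fderiv ℝ φ x (fderiv ℝ ψ (φ x) w) = w := by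
  have h1 : HasFDerivAt (φ ∘ ψ) ((fderiv ℝ φ (ψ (φ x))).comp (fderiv ℝ ψ (φ x))) (φ x) := by
    refine HasFDerivAt.comp _ (DifferentiableAt.hasFDerivAt ?_)
      (hf.differentiableAt_inv hV (hf.mapsTo hx)).hasFDerivAt
    rw [hf.invOn.1 hx]
    exact hf.differentiableAt hU hx
  have h2 : HasFDerivAt (φ ∘ ψ) (ContinuousLinearMap.id ℝ F) (φ x) := by
    refine (hasFDerivAt_id _).congr_of_eventuallyEq ?_
    filter_upwards [hV.mem_nhds (hf.mapsTo hx)] with y hy using hf.invOn.2 hy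
  rw [hf.invOn.1 hx] at h1
  exact DFunLike.congr_fun (h1.unique h2) w

theorem symm (hf : IsRiemIsometry U g V h φ ψ) (hU : IsOpen U) (hV : IsOpen V) :
    IsRiemIsometry V h U g ψ φ where
  mapsTo := hf.mapsTo_inv
  mapsTo_inv := hf.mapsTo
  invOn := hf.invOn.symm
  smooth := hf.smooth_inv
  smooth_inv := hf.smooth
  isometry y hy u v := by
    have hx := hf.mapsTo_inv hy
    have := hf.fderiv_apply_inv hU hV hx
    rw [hf.invOn.2 hy] at this
    rw [← hf.isometry _ hx, hf.invOn.2 hy, this, this]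

theorem const_mul (hf : IsRiemIsometry U g V h φ ψ) (c : ℝ) :
    IsRiemIsometry U (fun x u v => c * g x u v) V (fun x u v => c * h x u v) φ ψ where
  __ := hf
  isometry x hx u v := by simp only [hf.isometry x hx]

/-- Product rule applied to `g = φ^* h`; differentiability of `g` is inherited from `h`. -/
theorem metricDeriv_eq (hf : IsRiemIsometry U g V h φ ψ) (hU : IsOpen U) (hV : IsOpen V)
    (hh : IsDiffMetric V h) {x : E} (hx : x ∈ U) (u v w : E) :
    metricDeriv g x u v w =
      metricDeriv h (φ x) (fderiv ℝ φ x u) (fderiv ℝ φ x v) (fderiv ℝ φ x w)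
      + h (φ x) (fderiv ℝ (fderiv ℝ φ) x u v) (fderiv ℝ φ x w)
      + h (φ x) (fderiv ℝ φ x v) (fderiv ℝ (fderiv ℝ φ) x u w) := by
  obtain ⟨H, hH, hhH⟩ := hh.exists_form
  have hy := hf.mapsTo hx
  have hA := (hf.differentiableAt hU hx).hasFDerivAt
  have hB : HasFDerivAt (fderiv ℝ φ) (fderiv ℝ (fderiv ℝ φ) x) x :=
    (((hf.contDiffAt hU hx).fderiv_right (m := 1) (by norm_cast)).differentiableAt
      one_ne_zero).hasFDerivAt
  have hBv : ∀ v : E, HasFDerivAt (fun y => fderiv ℝ φ y v)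
      ((fderiv ℝ (fderiv ℝ φ) x).flip v) x := fun v => by
    simpa using hB.clm_apply (hasFDerivAt_const v x)
  have hHy : HasFDerivAt (fun y => H (φ y)) ((fderiv ℝ H (φ x)).comp (fderiv ℝ φ x)) x :=
    (hH _ hy).hasFDerivAt.comp x hA
  have key := (hHy.clm_apply (hBv v)).clm_apply (hBv w)
  have hgd : fderiv ℝ (fun y => g y v w) x = _ := (key.congr_of_eventuallyEq (by
    filter_upwards [hU.mem_nhds hx] with z hz
    rw [← hf.isometry z hz, hhH _ (hf.mapsTo hz)])).fderiv
  have hhd : ∀ p q : F, HasFDerivAt (fun y => h y p q)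
      (((fderiv ℝ H (φ x)).flip p).flip q) (φ x) := fun p q => by
    have := (((hH _ hy).hasFDerivAt.clm_apply (hasFDerivAt_const p (φ x))).clm_apply
      (hasFDerivAt_const q (φ x))).congr_of_eventuallyEq (f₁ := fun y => h y p q) (by
        filter_upwards [hV.mem_nhds hy] with z hz
        exact hhH z hz p q)
    simpa using this
  simp only [metricDeriv]
  rw [hgd, (hhd _ _).fderiv, hhH _ hy, hhH _ hy]
  simp
  ring

/-- In the Koszul combination the second-derivative terms cancel, by symmetry of `D²φ` and of `h`,
except for two equal copies of the one that remains. -/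
theorem christoffel_eq (hf : IsRiemIsometry U g V h φ ψ) (hU : IsOpen U) (hV : IsOpen V)
    (hh : IsDiffMetric V h) {x : E} (hx : x ∈ U) (u v w : E) :
    christoffel g x u v w =
      christoffel h (φ x) (fderiv ℝ φ x u) (fderiv ℝ φ x v) (fderiv ℝ φ x w)
      + h (φ x) (fderiv ℝ (fderiv ℝ φ) x u v) (fderiv ℝ φ x w) := by
  have hs : IsSymmSndFDerivAt ℝ φ x :=
    (hf.contDiffAt hU hx).isSymmSndFDerivAt (by simp; norm_cast)
  simp only [christoffel, hf.metricDeriv_eq hU hV hh hx]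
  rw [hs.eq v u, hs.eq w u, hs.eq w v, hh.symm _ (hf.mapsTo hx) (fderiv ℝ φ x u),
    hh.symm _ (hf.mapsTo hx) (fderiv ℝ φ x v)]
  ring

theorem contDiffOn_fderiv_apply (hf : IsRiemIsometry U g V h φ ψ) (hU : IsOpen U) {γ W : ℝ → E}
    (hγ : ContDiffOn ℝ 1 γ (Set.Icc 0 1)) (hγU : ∀ t ∈ Set.Icc (0 : ℝ) 1, γ t ∈ U)
    (hW : ContDiffOn ℝ 1 W (Set.Icc 0 1)) :
    ContDiffOn ℝ 1 (fun t => fderiv ℝ φ (γ t) (W t)) (Set.Icc 0 1) :=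
  ((hf.smooth.fderiv_of_isOpen hU (m := 1) (by norm_cast)).comp hγ hγU).clm_apply hW

/-- The term `D²φ(γ', W)` from differentiating `dφ(W)` along the curve is exactly the inhomogeneous
term of the Christoffel law. -/
theorem isParallelAlong_iff (hf : IsRiemIsometry U g V h φ ψ) (hU : IsOpen U) (hV : IsOpen V)
    (hh : IsDiffMetric V h) {γ W : ℝ → E} (hγ : ContDiffOn ℝ 1 γ (Set.Icc 0 1))
    (hγU : ∀ t ∈ Set.Icc (0 : ℝ) 1, γ t ∈ U) (hW : ContDiffOn ℝ 1 W (Set.Icc 0 1)) :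
    IsParallelAlong h (φ ∘ γ) (fun t => fderiv ℝ φ (γ t) (W t)) ↔ IsParallelAlong g γ W := by
  have key : ∀ t ∈ Set.Icc (0 : ℝ) 1, ∀ w : E,
      h ((φ ∘ γ) t) (velocity (fun t => fderiv ℝ φ (γ t) (W t)) t) (fderiv ℝ φ (γ t) w)
        + christoffel h ((φ ∘ γ) t) (velocity (φ ∘ γ) t) (fderiv ℝ φ (γ t) (W t))
          (fderiv ℝ φ (γ t) w) =
      g (γ t) (velocity W t) w + christoffel g (γ t) (velocity γ t) (W t) w := by
    intro t ht w
    have hx := hγU t ht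
    obtain ⟨H, -, hhH⟩ := hh.exists_form
    have hB : DifferentiableAt ℝ (fderiv ℝ φ) (γ t) :=
      ((hf.contDiffAt hU hx).fderiv_right (m := 1) (by norm_cast)).differentiableAt one_ne_zero
    rw [hf.christoffel_eq hU hV hh hx, velocity_comp hγ ht (hf.differentiableAt hU hx),
      velocity_clm_apply hγ hW ht hB, ← hf.isometry _ hx]
    simp only [Function.comp_apply, hhH _ (hf.mapsTo hx), map_add, add_apply]
    ring
  constructor
  · rintro ⟨-, h2⟩
    refine ⟨hW, fun t ht w => ?_⟩
    rw [← key t ht]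
    exact h2 t ht _
  · rintro ⟨-, h2⟩
    refine ⟨hf.contDiffOn_fderiv_apply hU hγ hγU hW, fun t ht w => ?_⟩
    -- Since `dφ` is onto, every test vector has the form required by `key`.
    rw [← hf.fderiv_apply_inv hU hV (hγU t ht) w, key t ht]
    exact h2 t ht _

theorem isGeodesic_iff (hf : IsRiemIsometry U g V h φ ψ) (hU : IsOpen U) (hV : IsOpen V)
    (hh : IsDiffMetric V h) {γ : ℝ → E} (hγ : ContDiffOn ℝ 2 γ (Set.Icc 0 1))
    (hγU : ∀ t ∈ Set.Icc (0 : ℝ) 1, γ t ∈ U) :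
    IsGeodesic V h (φ ∘ γ) ↔ IsGeodesic U g γ := by
  have hγ1 : ContDiffOn ℝ 1 γ (Set.Icc 0 1) := hγ.of_le (by norm_num)
  have hv : ContDiffOn ℝ 1 (velocity γ) (Set.Icc 0 1) :=
    hγ.derivWithin (uniqueDiffOn_Icc zero_lt_one) (by norm_num)
  have hvel : Set.EqOn (velocity (φ ∘ γ)) (fun t => fderiv ℝ φ (γ t) (velocity γ t))
      (Set.Icc 0 1) := fun t ht => velocity_comp hγ1 ht (hf.differentiableAt hU (hγU t ht))
  have hp := hf.isParallelAlong_iff hU hV hh hγ1 hγU hv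
  constructor
  · rintro ⟨-, -, h3⟩
    exact ⟨hγ, hγU, hp.1 (h3.congr (fun _ _ => rfl) hvel.symm)⟩
  · rintro ⟨-, -, h3⟩
    exact ⟨(hf.smooth.of_le (by norm_cast)).comp hγ hγU, fun t ht => hf.mapsTo (hγU t ht),
      (hp.2 h3).congr (fun _ _ => rfl) hvel⟩

/-- Applying the equivalence to `ψ ∘ η`, rather than using the inverse isometry, avoids asking that
`g` be a differentiable metric. -/
theorem isGeodesic_inv_comp (hf : IsRiemIsometry U g V h φ ψ) (hU : IsOpen U) (hV : IsOpen V)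
    (hh : IsDiffMetric V h) {η : ℝ → F} (hη : IsGeodesic V h η) : IsGeodesic U g (ψ ∘ η) :=
  (hf.isGeodesic_iff hU hV hh ((hf.smooth_inv.of_le (by norm_cast)).comp hη.1 hη.2.1)
    fun t ht => hf.mapsTo_inv (hη.2.1 t ht)).1
    (hη.congr fun t ht => hf.invOn.2 (hη.2.1 t ht))

theorem expRel (hf : IsRiemIsometry U g V h φ ψ) (hU : IsOpen U) (hV : IsOpen V)
    (hh : IsDiffMetric V h) {x v y : E} (he : ExpRel U g x v y) :
    ExpRel V h (φ x) (fderiv ℝ φ x v) (φ y) := by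
  obtain ⟨γ, hγ, rfl, rfl, rfl⟩ := he
  exact ⟨φ ∘ γ, (hf.isGeodesic_iff hU hV hh hγ.1 hγ.2.1).2 hγ, rfl,
    velocity_comp (hγ.1.of_le (by norm_num)) zero_mem_unitInterval
      (hf.differentiableAt hU (hγ.2.1 _ zero_mem_unitInterval)), rfl⟩

theorem expRel_inv (hf : IsRiemIsometry U g V h φ ψ) (hU : IsOpen U) (hV : IsOpen V)
    (hh : IsDiffMetric V h) {x v y : F} (he : ExpRel V h x v y) :
    ExpRel U g (ψ x) (fderiv ℝ ψ x v) (ψ y) := by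
  obtain ⟨η, hη, rfl, rfl, rfl⟩ := he
  exact ⟨ψ ∘ η, hf.isGeodesic_inv_comp hU hV hh hη, rfl,
    velocity_comp (hη.1.of_le (by norm_num)) zero_mem_unitInterval
      (hf.differentiableAt_inv hV (hη.2.1 _ zero_mem_unitInterval)), rfl⟩

end IsRiemIsometry

/-! ### Values of the partial maps lie in the manifold -/

theorem ExpRel.mem {x v y : E} (he : ExpRel U g x v y) : y ∈ U := by
  obtain ⟨γ, hγ, -, -, rfl⟩ := he
  exact hγ.2.1 _ one_mem_unitInterval

theorem mem_of_mem_riemExp {x v y : E} (hy : y ∈ riemExp U g x v) : y ∈ U :=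
  (mem_uniqueVal.1 hy).1.mem

theorem mem_of_mem_shift {x y p q : E} (hq : q ∈ shift U g x y p) : q ∈ U := by
  simp only [shift, Part.mem_bind_iff] at hq
  obtain ⟨_, -, _, -, hq⟩ := hq
  exact mem_of_mem_riemExp hq

theorem mem_of_mem_rescale {x p q : E} {c : ℝ} (hq : q ∈ rescale U g x c p) : q ∈ U := by
  simp only [rescale, Part.mem_bind_iff] at hq
  obtain ⟨_, -, hq⟩ := hq
  exact mem_of_mem_riemExp hq

theorem mem_of_mem_wfm {N : ℕ} {w : Fin N → ℝ} {X : Fin N → E} {B : E} (hB : B ∈ wfm U g w X) :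
    B ∈ U :=
  (mem_uniqueVal.1 hB).1.1

/-! ### Naturality of exponential, logarithm, transport and normalisation -/

namespace IsRiemIsometry

theorem riemExp_eq (hf : IsRiemIsometry U g V h φ ψ) (hU : IsOpen U) (hV : IsOpen V)
    (hh : IsDiffMetric V h) {x : E} (hx : x ∈ U) (v : E) :
    riemExp U g x v = (riemExp V h (φ x) (fderiv ℝ φ x v)).map ψ := by
  refine uniqueVal_eq_map ψ φ (fun y hy => ⟨hf.expRel hU hV hh hy, hf.invOn.1 hy.mem⟩)
    fun y hy => ⟨?_, hf.invOn.2 hy.mem⟩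
  have := hf.expRel_inv hU hV hh hy
  rwa [hf.invOn.1 hx, hf.fderiv_inv_apply hU hV hx] at this

theorem riemLog_eq (hf : IsRiemIsometry U g V h φ ψ) (hU : IsOpen U) (hV : IsOpen V)
    (hh : IsDiffMetric V h) {x y : E} (hx : x ∈ U) (hy : y ∈ U) :
    riemLog U g x y = (riemLog V h (φ x) (φ y)).map (fderiv ℝ ψ (φ x)) := by
  refine uniqueVal_eq_map _ (fderiv ℝ φ x)
    (fun v hv => ⟨hf.expRel hU hV hh hv, hf.fderiv_inv_apply hU hV hx v⟩)
    fun v hv => ⟨?_, hf.fderiv_apply_inv hU hV hx v⟩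
  have := hf.expRel_inv hU hV hh hv
  rwa [hf.invOn.1 hx, hf.invOn.1 hy] at this

theorem parTransport_eq (hf : IsRiemIsometry U g V h φ ψ) (hU : IsOpen U) (hV : IsOpen V)
    (hh : IsDiffMetric V h) {x y : E} (hx : x ∈ U) (hy : y ∈ U) (v : E) :
    parTransport U g x y v =
      (parTransport V h (φ x) (φ y) (fderiv ℝ φ x v)).map (fderiv ℝ ψ (φ y)) := by
  refine uniqueVal_eq_map _ (fderiv ℝ φ y) (fun w hw => ⟨?_, hf.fderiv_inv_apply hU hV hy w⟩)
    fun w hw => ⟨?_, hf.fderiv_apply_inv hU hV hy w⟩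
  · obtain ⟨γ, W, hγ, rfl, rfl, hW, rfl, rfl⟩ := hw
    exact ⟨φ ∘ γ, fun t => fderiv ℝ φ (γ t) (W t), (hf.isGeodesic_iff hU hV hh hγ.1 hγ.2.1).2 hγ,
      rfl, rfl, (hf.isParallelAlong_iff hU hV hh (hγ.1.of_le (by norm_num)) hγ.2.1 hW.1).2 hW,
      rfl, rfl⟩
  · obtain ⟨η, W, hη, hη0, hη1, hW, hW0, rfl⟩ := hw
    have hη1' : ContDiffOn ℝ 1 η (Set.Icc 0 1) := hη.1.of_le (by norm_num)
    have hg := hf.isGeodesic_inv_comp hU hV hh hη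
    refine ⟨ψ ∘ η, fun t => fderiv ℝ ψ (η t) (W t), hg, ?_, ?_, ?_, ?_, ?_⟩
    · rw [Function.comp_apply, hη0, hf.invOn.1 hx]
    · rw [Function.comp_apply, hη1, hf.invOn.1 hy]
    -- Pushing the pulled-back field forward again recovers `W` on `[0, 1]`.
    · refine (hf.isParallelAlong_iff hU hV hh (hg.1.of_le (by norm_num)) hg.2.1
        ((hf.symm hU hV).contDiffOn_fderiv_apply hV hη1' hη.2.1 hW.1)).1
        (hW.congr (fun t ht => hf.invOn.2 (hη.2.1 t ht)) fun t ht => ?_)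
      have := hf.fderiv_apply_inv hU hV (hg.2.1 t ht) (W t)
      rwa [Function.comp_apply, hf.invOn.2 (hη.2.1 t ht)] at this
    · simp only [hη0, hW0, hf.fderiv_inv_apply hU hV hx]
    · simp only [hη1]

theorem shift_eq (hf : IsRiemIsometry U g V h φ ψ) (hU : IsOpen U) (hV : IsOpen V)
    (hh : IsDiffMetric V h) {x y p : E} (hx : x ∈ U) (hy : y ∈ U) (hp : p ∈ U) :
    shift U g x y p = (shift V h (φ x) (φ y) (φ p)).map ψ := by
  simp only [shift, hf.riemLog_eq hU hV hh hx hp, hf.parTransport_eq hU hV hh hx hy,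
    hf.riemExp_eq hU hV hh hy, Part.bind_map, Part.map_bind, hf.fderiv_apply_inv hU hV hx,
    hf.fderiv_apply_inv hU hV hy]

theorem rescale_eq (hf : IsRiemIsometry U g V h φ ψ) (hU : IsOpen U) (hV : IsOpen V)
    (hh : IsDiffMetric V h) {x p : E} (hx : x ∈ U) (hp : p ∈ U) (c : ℝ) :
    rescale U g x c p = (rescale V h (φ x) c (φ p)).map ψ := by
  simp only [rescale, hf.riemLog_eq hU hV hh hx hp, hf.riemExp_eq hU hV hh hx, Part.bind_map,
    Part.map_bind, map_smul, hf.fderiv_apply_inv hU hV hx]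

theorem normalize_eq (hf : IsRiemIsometry U g V h φ ψ) (hU : IsOpen U) (hV : IsOpen V)
    (hh : IsDiffMetric V h) {R G B p : E} (hR : R ∈ U) (hG : G ∈ U) (hB : B ∈ U) (hp : p ∈ U)
    (ε s var : ℝ) :
    normalize U g R ε s G B var p = (normalize V h (φ R) ε s (φ G) (φ B) var (φ p)).map ψ := by
  simp only [normalize, hf.shift_eq hU hV hh hB hR hp, Part.bind_map, Part.map_bind]
  refine bind_congr_of_mem fun q hq => ?_
  have hq := mem_of_mem_shift hq
  rw [hf.rescale_eq hU hV hh hR (hf.mapsTo_inv hq), Part.bind_map, hf.invOn.2 hq]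
  refine bind_congr_of_mem fun q' hq' => ?_
  have hq' := mem_of_mem_rescale hq'
  rw [hf.shift_eq hU hV hh hR hG (hf.mapsTo_inv hq'), hf.invOn.2 hq']

/-! ### Lengths, distances and Fréchet statistics under isometries -/

theorem curveLength_comp (hf : IsRiemIsometry U g V h φ ψ) (hU : IsOpen U) {γ : ℝ → E}
    (hγ : ContDiffOn ℝ 1 γ (Set.Icc 0 1)) (hγU : ∀ t ∈ Set.Icc (0 : ℝ) 1, γ t ∈ U) :
    curveLength h (φ ∘ γ) = curveLength g γ := by
  refine intervalIntegral.integral_congr fun t ht => ?_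
  rw [Set.uIcc_of_le zero_le_one] at ht
  rw [velocity_comp hγ ht (hf.differentiableAt hU (hγU t ht)), Function.comp_apply,
    hf.isometry _ (hγU t ht)]

/-- The two sets of lengths coincide, so nothing about connectedness or attainment of the infimum
enters. -/
theorem riemDist_eq (hf : IsRiemIsometry U g V h φ ψ) (hU : IsOpen U) (hV : IsOpen V) {x y : E}
    (hx : x ∈ U) (hy : y ∈ U) : riemDist U g x y = riemDist V h (φ x) (φ y) := by
  unfold riemDist
  congr 1
  ext l
  constructor
  · rintro ⟨γ, hγ, hγU, rfl, rfl, rfl⟩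
    exact ⟨φ ∘ γ, (hf.smooth.of_le (by norm_cast)).comp hγ hγU, fun t ht => hf.mapsTo (hγU t ht),
      rfl, rfl, hf.curveLength_comp hU hγ hγU⟩
  · rintro ⟨η, hη, hηV, h0, h1, rfl⟩
    refine ⟨ψ ∘ η, (hf.smooth_inv.of_le (by norm_cast)).comp hη hηV,
      fun t ht => hf.mapsTo_inv (hηV t ht), ?_, ?_, (hf.symm hU hV).curveLength_comp hV hη hηV⟩
    · rw [Function.comp_apply, h0, hf.invOn.1 hx]
    · rw [Function.comp_apply, h1, hf.invOn.1 hy]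

theorem frechetMeans_eq (hf : IsRiemIsometry U g V h φ ψ) (hU : IsOpen U) (hV : IsOpen V) {N : ℕ}
    (w : Fin N → ℝ) {X : Fin N → E} (hX : ∀ i, X i ∈ U) :
    frechetMeans U g w X = ψ '' frechetMeans V h w (fun i => φ (X i)) := by
  have key : ∀ Y ∈ U, ∑ i, w i * riemDist U g Y (X i) ^ 2 =
      ∑ i, w i * riemDist V h (φ Y) (φ (X i)) ^ 2 := fun Y hY => by
    simp only [hf.riemDist_eq hU hV hY (hX _)]
  ext B
  constructor
  · rintro ⟨hB, hmin⟩
    refine ⟨φ B, ⟨hf.mapsTo hB, fun Y hY => ?_⟩, hf.invOn.1 hB⟩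
    have := hmin (ψ Y) (hf.mapsTo_inv hY)
    rwa [key B hB, key _ (hf.mapsTo_inv hY), hf.invOn.2 hY] at this
  · rintro ⟨C, ⟨hC, hmin⟩, rfl⟩
    refine ⟨hf.mapsTo_inv hC, fun Y hY => ?_⟩
    rw [key _ (hf.mapsTo_inv hC), key Y hY, hf.invOn.2 hC]
    exact hmin _ (hf.mapsTo hY)

theorem wfm_eq (hf : IsRiemIsometry U g V h φ ψ) (hU : IsOpen U) (hV : IsOpen V) {N : ℕ}
    (w : Fin N → ℝ) {X : Fin N → E} (hX : ∀ i, X i ∈ U) :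
    wfm U g w X = (wfm V h w (fun i => φ (X i))).map ψ := by
  unfold wfm
  rw [hf.frechetMeans_eq hU hV w hX]
  refine uniqueVal_eq_map ψ φ ?_ fun B hB => ⟨⟨B, hB, rfl⟩, hf.invOn.2 hB.1⟩
  rintro _ ⟨B, hB, rfl⟩
  rw [hf.invOn.2 hB.1]
  exact ⟨hB, rfl⟩

theorem frechetVar_eq (hf : IsRiemIsometry U g V h φ ψ) (hU : IsOpen U) (hV : IsOpen V) {N : ℕ}
    {B : E} (hB : B ∈ U) {X : Fin N → E} (hX : ∀ i, X i ∈ U) :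
    frechetVar U g B X = frechetVar V h (φ B) (fun i => φ (X i)) := by
  simp only [frechetVar, hf.riemDist_eq hU hV hB (hX _)]

/-! ### Naturality of batch normalisation -/

theorem rbnTrain_eq (hf : IsRiemIsometry U g V h φ ψ) (hU : IsOpen U) (hV : IsOpen V)
    (hh : IsDiffMetric V h) (κ ε s : ℝ) {R G : E} (hR : R ∈ U) (hG : G ∈ U) {N : ℕ}
    {X : Fin N → E} (hX : ∀ i, X i ∈ U) (i : Fin N) :
    rbnTrain U g κ R ε s G X i =
      (rbnTrain V h κ (φ R) ε s (φ G) (fun j => φ (X j)) i).map ψ := by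
  simp only [rbnTrain, hf.wfm_eq hU hV _ hX, Part.bind_map, Part.map_bind]
  refine bind_congr_of_mem fun B hB => ?_
  have hB := mem_of_mem_wfm hB
  rw [hf.normalize_eq hU hV hh hR hG (hf.mapsTo_inv hB) (hX i),
    hf.frechetVar_eq hU hV (hf.mapsTo_inv hB) hX, hf.invOn.2 hB]

theorem rbnUpdate_eq (hf : IsRiemIsometry U g V h φ ψ) (hU : IsOpen U) (hV : IsOpen V)
    (κ m : ℝ) {N : ℕ} {X : Fin N → E} (hX : ∀ i, X i ∈ U) {σ : RunStats E} (hσ : σ.mean ∈ U) :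
    rbnUpdate U g κ m X σ =
      (rbnUpdate V h κ m (fun j => φ (X j)) (σ.map φ)).map (RunStats.map ψ) := by
  simp only [rbnUpdate, hf.wfm_eq hU hV _ hX, Part.bind_map, Part.map_bind]
  refine bind_congr_of_mem fun B hB => ?_
  have hB := mem_of_mem_wfm hB
  have hpair : ∀ i, (![σ.mean, ψ B] : Fin 2 → E) i ∈ U := by
    simpa [Fin.forall_fin_two] using ⟨hσ, hf.mapsTo_inv hB⟩
  have hmap : (fun i => φ ((![σ.mean, ψ B] : Fin 2 → E) i)) = ![(σ.map φ).mean, B] := by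
    funext i
    fin_cases i
    · rfl
    · exact hf.invOn.2 hB
  rw [hf.wfm_eq hU hV _ hpair, hmap, Part.map_map, Part.map_map,
    hf.frechetVar_eq hU hV (hf.mapsTo_inv hB) hX, hf.invOn.2 hB]
  rfl

theorem rbnTest_eq (hf : IsRiemIsometry U g V h φ ψ) (hU : IsOpen U) (hV : IsOpen V)
    (hh : IsDiffMetric V h) (ε s : ℝ) {R G p : E} (hR : R ∈ U) (hG : G ∈ U) (hp : p ∈ U)
    {σ : RunStats E} (hσ : σ.mean ∈ U) :
    rbnTest U g R ε s G σ p = (rbnTest V h (φ R) ε s (φ G) (σ.map φ) (φ p)).map ψ :=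
  hf.normalize_eq hU hV hh hR hG hσ hp _ _ _

end IsRiemIsometry

/-! ### Scaling of the metric -/

theorem IsDiffMetric.const_mul (hg : IsDiffMetric U g) (c : ℝ) :
    IsDiffMetric U (fun x u v => c * g x u v) := by
  obtain ⟨G, hG, hgG⟩ := hg.exists_form
  refine ⟨⟨fun x => c • G x, fun x hx => (hG x hx).fun_const_smul c, fun x hx u v => ?_⟩,
    fun x hx u v => by rw [hg.symm x hx]⟩
  simp [hgG x hx]

theorem christoffel_const_mul (g : E → E → E → ℝ) (c : ℝ) (x u v w : E) :
    christoffel (fun x u v => c * g x u v) x u v w = c * christoffel g x u v w := by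
  have : ∀ u v w, metricDeriv (fun x u v => c * g x u v) x u v w = c * metricDeriv g x u v w :=
    fun u v w => by
      exact DFunLike.congr_fun (congrFun (fderiv_const_smul_field (f := fun y => g y v w) c) x) u
  simp only [christoffel, this]
  ring

variable {c : ℝ}

/-- Both terms of the parallelism equation scale by `c`, and its right side is zero. -/
theorem isParallelAlong_const_mul (hc : 0 < c) :
    IsParallelAlong (fun x u v => c * g x u v) = IsParallelAlong g := by
  ext γ W
  simp only [IsParallelAlong, christoffel_const_mul, ← mul_add, mul_eq_zero, hc.ne', false_or]

theorem normalize_const_mul (hc : 0 < c) :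
    normalize U (fun x u v => c * g x u v) = normalize U g := by
  funext R ε s G B var p
  simp only [normalize, shift, rescale, riemLog, riemExp, parTransport, ExpRel, IsGeodesic,
    isParallelAlong_const_mul hc]

open Pointwise in
theorem riemDist_const_mul (hc : 0 < c) (x y : E) :
    riemDist U (fun x u v => c * g x u v) x y = Real.sqrt c * riemDist U g x y := by
  have hlen : ∀ γ : ℝ → E,
      curveLength (fun x u v => c * g x u v) γ = Real.sqrt c * curveLength g γ := fun γ => by
    simp only [curveLength, Real.sqrt_mul hc.le, intervalIntegral.integral_const_mul]
  unfold riemDist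
  rw [← smul_eq_mul, ← Real.sInf_smul_of_nonneg (Real.sqrt_nonneg c)]
  congr 1
  ext l
  simp only [Set.mem_smul_set, hlen, smul_eq_mul]
  constructor
  · rintro ⟨γ, h1, h2, h3, h4, rfl⟩
    exact ⟨_, ⟨γ, h1, h2, h3, h4, rfl⟩, rfl⟩
  · rintro ⟨_, ⟨γ, h1, h2, h3, h4, rfl⟩, rfl⟩
    exact ⟨γ, h1, h2, h3, h4, rfl⟩

theorem riemDist_const_mul_sq (hc : 0 < c) (x y : E) :
    riemDist U (fun x u v => c * g x u v) x y ^ 2 = c * riemDist U g x y ^ 2 := by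
  rw [riemDist_const_mul hc, mul_pow, Real.sq_sqrt hc.le]

theorem frechetVar_const_mul (hc : 0 < c) {N : ℕ} (B : E) (X : Fin N → E) :
    frechetVar U (fun x u v => c * g x u v) B X = c * frechetVar U g B X := by
  simp only [frechetVar, riemDist_const_mul_sq hc, ← Finset.mul_sum]
  ring

theorem frechetMeans_const_mul (hc : 0 < c) {N : ℕ} (w : Fin N → ℝ) (X : Fin N → E) :
    frechetMeans U (fun x u v => c * g x u v) w X = frechetMeans U g w X := by
  simp only [frechetMeans, riemDist_const_mul_sq hc, mul_left_comm _ c, ← Finset.mul_sum,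
    mul_le_mul_iff_right₀ hc]

theorem wfm_const_mul (hc : 0 < c) {N : ℕ} (w : Fin N → ℝ) (X : Fin N → E) :
    wfm U (fun x u v => c * g x u v) w X = wfm U g w X := by
  simp only [wfm, frechetMeans_const_mul hc]

/-- The batch variance is the only place where a constant in the metric is felt, so it reappears as
the variance factor. -/
theorem rbnTrain_const_mul (hc : 0 < c) (R : E) (ε s : ℝ) (G : E) {N : ℕ} (X : Fin N → E)
    (i : Fin N) :
    rbnTrain U (fun x u v => c * g x u v) 1 R ε s G X i = rbnTrain U g c R ε s G X i := by
  simp only [rbnTrain, wfm_const_mul hc, normalize_const_mul hc, frechetVar_const_mul hc, one_mul]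

theorem rbnUpdate_const_mul (hc : 0 < c) (m : ℝ) {N : ℕ} (X : Fin N → E) (σ : RunStats E) :
    rbnUpdate U (fun x u v => c * g x u v) 1 m X σ = rbnUpdate U g c m X σ := by
  simp only [rbnUpdate, wfm_const_mul hc, frechetVar_const_mul hc, one_mul]

theorem rbnTest_const_mul (hc : 0 < c) (R : E) (ε s : ℝ) (G : E) (σ : RunStats E) (p : E) :
    rbnTest U (fun x u v => c * g x u v) R ε s G σ p = rbnTest U g R ε s G σ p := by
  simp only [rbnTest, normalize_const_mul hc]

end RiemChart

set_option maxSynthPendingDepth 3 in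
/-- The binomial series converges on the unit ball of every normed algebra. -/
theorem one_le_radius_binomialSeries {𝔸 : Type*} [NormedRing 𝔸] [NormedAlgebra ℝ 𝔸] (a : ℝ) :
    1 ≤ (binomialSeries 𝔸 a).radius := by
  refine ENNReal.le_of_forall_nnreal_lt fun r hr => ?_
  obtain ⟨C, hC, hb⟩ := (binomialSeries ℝ a).norm_mul_pow_le_of_lt_radius
    (hr.trans_le (binomialSeries_radius_ge_one (𝕂 := ℝ)))
  -- Positive degrees are dominated by the scalar series; degree zero is bounded separately, as `‖1‖
  -- = 1` is not assumed in `𝔸`.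
  refine FormalMultilinearSeries.le_radius_of_bound _ (‖binomialSeries 𝔸 a 0‖ + C) fun n => ?_
  rcases Nat.eq_zero_or_pos n with rfl | hn
  · simpa using hC.le
  · have h1 : ‖binomialSeries 𝔸 a n‖ ≤ ‖binomialSeries ℝ a n‖ := by
      rw [binomialSeries, binomialSeries, FormalMultilinearSeries.ofScalars_norm (E := ℝ)]
      exact FormalMultilinearSeries.ofScalars_norm_le _ _ _ hn
    calc _ ≤ ‖binomialSeries ℝ a n‖ * (r : ℝ) ^ n := by gcongr
      _ ≤ C := hb n
      _ ≤ _ := le_add_of_nonneg_left (norm_nonneg _)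

namespace SPD

set_option maxSynthPendingDepth 3

variable {d : ℕ}

/-- Operators on the Euclidean space. -/
abbrev Op (d : ℕ) : Type := EuclideanSpace ℝ (Fin d) →L[ℝ] EuclideanSpace ℝ (Fin d)

/-! ### Smoothness of the matrix power -/

/-- The operator of a symmetric matrix. -/
noncomputable def toOp : Sym d →ₗ[ℝ] Op d :=
  (Matrix.toEuclideanCLM (n := Fin d) (𝕜 := ℝ)).toAlgEquiv.toLinearMap ∘ₗ
    (selfAdjoint.submodule ℝ (Matrix (Fin d) (Fin d) ℝ)).subtype

theorem continuous_toOp : Continuous (toOp (d := d)) := LinearMap.continuous_of_finiteDimensional _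

theorem toOp_injective : Function.Injective (toOp (d := d)) :=
  (Matrix.toEuclideanCLM (n := Fin d) (𝕜 := ℝ)).injective.comp Subtype.val_injective

/-- Operators, with matrices taken in an eigenbasis of `X`. -/
noncomputable def eigenAlgEquiv (X : Sym d) : Matrix (Fin d) (Fin d) ℝ ≃⋆ₐ[ℝ] Op d :=
  (Unitary.conjStarAlgAut ℝ _ X.isHermitian.eigenvectorUnitary).trans Matrix.toEuclideanCLM

theorem toOp_eq (X : Sym d) :
    toOp X = eigenAlgEquiv X (Matrix.diagonal X.isHermitian.eigenvalues) :=
  congrArg (Matrix.toEuclideanCLM (n := Fin d) (𝕜 := ℝ)) X.isHermitian.spectral_theorem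

theorem toOp_power (a : ℝ) (X : Sym d) :
    toOp (power a X) =
      eigenAlgEquiv X (Matrix.diagonal fun i => X.isHermitian.eigenvalues i ^ a) := rfl

/-- Unitary conjugation preserves the operator norm. The operator norm is used because, unlike the
Frobenius norm, it reads off the largest absolute eigenvalue. -/
theorem norm_eigenAlgEquiv_diagonal (X : Sym d) (v : Fin d → ℝ) :
    ‖eigenAlgEquiv X (Matrix.diagonal v)‖ = ‖v‖ := by
  have hU := Unitary.map_mem (Matrix.toEuclideanCLM (n := Fin d) (𝕜 := ℝ))
    X.isHermitian.eigenvectorUnitary.2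
  have : eigenAlgEquiv X (Matrix.diagonal v) =
      Matrix.toEuclideanCLM (n := Fin d) (𝕜 := ℝ)
        (X.isHermitian.eigenvectorUnitary : Matrix (Fin d) (Fin d) ℝ) *
      Matrix.toEuclideanCLM (n := Fin d) (𝕜 := ℝ) (Matrix.diagonal v) *
      star (Matrix.toEuclideanCLM (n := Fin d) (𝕜 := ℝ)
        (X.isHermitian.eigenvectorUnitary : Matrix (Fin d) (Fin d) ℝ)) := by
    rw [← map_star, ← map_mul, ← map_mul]
    rfl
  rw [this, CStarRing.norm_mul_mem_unitary _ (Unitary.star_mem hU),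
    CStarRing.norm_mem_unitary_mul _ hU]
  exact (Matrix.l2_opNorm_toEuclideanCLM _).trans (Matrix.l2_opNorm_diagonal v)

theorem smul_toOp_sub_one (c : ℝ) (X : Sym d) :
    c⁻¹ • toOp X - 1 =
      eigenAlgEquiv X (Matrix.diagonal fun i => c⁻¹ * X.isHermitian.eigenvalues i - 1) := by
  have h : (Matrix.diagonal fun i => c⁻¹ * X.isHermitian.eigenvalues i - 1) =
      c⁻¹ • Matrix.diagonal X.isHermitian.eigenvalues - 1 := by
    rw [← Matrix.diagonal_smul, ← Matrix.diagonal_one, Matrix.diagonal_sub]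
    rfl
  rw [h, map_sub, map_smul, map_one, toOp_eq]

theorem norm_smul_toOp_sub_one_lt_iff (c : ℝ) (X : Sym d) :
    ‖c⁻¹ • toOp X - 1‖ < 1 ↔ ∀ i, |c⁻¹ * X.isHermitian.eigenvalues i - 1| < 1 := by
  rw [smul_toOp_sub_one, norm_eigenAlgEquiv_diagonal, pi_norm_lt_iff one_pos]
  rfl

theorem mem_spd_iff (X : Sym d) : X ∈ spd d ↔ ∀ i, 0 < X.isHermitian.eigenvalues i :=
  X.isHermitian.posDef_iff_eigenvalues_pos

theorem mem_spd_of_norm_lt {c : ℝ} (hc : 0 < c) {X : Sym d} (h : ‖c⁻¹ • toOp X - 1‖ < 1) :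
    X ∈ spd d := by
  rw [norm_smul_toOp_sub_one_lt_iff] at h
  refine (mem_spd_iff X).2 fun i => ?_
  have := (abs_lt.1 (h i)).1
  exact pos_of_mul_pos_right (a := c⁻¹) (by linarith) (by positivity)

theorem exists_norm_lt {X : Sym d} (hX : X ∈ spd d) :
    ∃ c : ℝ, 0 < c ∧ ‖c⁻¹ • toOp X - 1‖ < 1 := by
  rw [mem_spd_iff] at hX
  have hs : 0 ≤ ∑ i, X.isHermitian.eigenvalues i := Finset.sum_nonneg fun i _ => (hX i).le
  -- One plus the trace exceeds every eigenvalue, and is positive even for `d = 0`.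
  refine ⟨1 + ∑ i, X.isHermitian.eigenvalues i, by positivity, ?_⟩
  rw [norm_smul_toOp_sub_one_lt_iff]
  intro i
  have hi := Finset.single_le_sum (f := X.isHermitian.eigenvalues) (fun j _ => (hX j).le)
    (Finset.mem_univ i)
  have h0 := hX i
  have h1 : (1 + ∑ i, X.isHermitian.eigenvalues i)⁻¹ * X.isHermitian.eigenvalues i < 1 := by
    rw [inv_mul_lt_one₀ (by positivity)]
    linarith
  have h2 : 0 < (1 + ∑ i, X.isHermitian.eigenvalues i)⁻¹ * X.isHermitian.eigenvalues i := by
    positivity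
  rw [abs_lt]
  constructor <;> linarith

theorem isOpen_setOf_norm_lt (c : ℝ) : IsOpen {X : Sym d | ‖c⁻¹ • toOp X - 1‖ < 1} :=
  isOpen_lt (((continuous_toOp.const_smul c⁻¹).sub continuous_const).norm) continuous_const

theorem isOpen_spd : IsOpen (spd d) := by
  refine isOpen_iff_mem_nhds.2 fun X hX => ?_
  obtain ⟨c, hc, h⟩ := exists_norm_lt hX
  filter_upwards [(isOpen_setOf_norm_lt c).mem_nhds h] with Y hY using mem_spd_of_norm_lt hc hY

/-- Near `c • 1` the matrix power is given by the binomial series. -/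
theorem toOp_power_eq_sum (a : ℝ) {c : ℝ} (hc : 0 < c) {X : Sym d}
    (h : ‖c⁻¹ • toOp X - 1‖ < 1) :
    toOp (power a X) = c ^ a • (binomialSeries (Op d) a).sum (c⁻¹ • toOp X - 1) := by
  have hlt := (norm_smul_toOp_sub_one_lt_iff c X).1 h
  -- The scalar binomial series is summed at each eigenvalue, then carried over by the eigenbasis
  -- isomorphism.
  have h1 : HasSum (fun n : ℕ => Matrix.diagonal fun i =>
      Ring.choose a n * (c⁻¹ * X.isHermitian.eigenvalues i - 1) ^ n)
      (Matrix.diagonal fun i => (c⁻¹ * X.isHermitian.eigenvalues i) ^ a) := by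
    refine HasSum.matrix_diagonal (Pi.hasSum.2 fun i => ?_)
    have := (Real.one_add_rpow_hasFPowerSeriesOnBall_zero (a := a)).hasSum
      (y := c⁻¹ * X.isHermitian.eigenvalues i - 1) (by
        rw [← ENNReal.ofReal_one, Metric.eball_ofReal]
        simpa using hlt i)
    simpa [binomialSeries, FormalMultilinearSeries.coeff_ofScalars, mul_comm] using this
  have h2 := h1.mapL ((eigenAlgEquiv X).toAlgEquiv.toLinearMap.toContinuousLinearMap)
  have hterm : (fun n : ℕ => binomialSeries (Op d) a n fun _ => c⁻¹ • toOp X - 1) =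
      fun n : ℕ => eigenAlgEquiv X (Matrix.diagonal fun i =>
        Ring.choose a n * (c⁻¹ * X.isHermitian.eigenvalues i - 1) ^ n) := by
    funext n
    have hd : (Matrix.diagonal fun i =>
        Ring.choose a n * (c⁻¹ * X.isHermitian.eigenvalues i - 1) ^ n) =
        Ring.choose a n • (Matrix.diagonal fun i => c⁻¹ * X.isHermitian.eigenvalues i - 1) ^ n := by
      rw [Matrix.diagonal_pow, ← Matrix.diagonal_smul]
      rfl
    rw [binomialSeries_apply, List.ofFn_const, List.prod_replicate, smul_toOp_sub_one, hd,
      ← map_pow, ← map_smul]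
  have h3 : HasSum (fun n : ℕ => binomialSeries (Op d) a n fun _ => c⁻¹ • toOp X - 1)
      (eigenAlgEquiv X (Matrix.diagonal fun i => (c⁻¹ * X.isHermitian.eigenvalues i) ^ a)) := by
    rw [hterm]
    exact h2
  have h4 : (binomialSeries (Op d) a).sum (c⁻¹ • toOp X - 1) = _ := h3.tsum_eq
  rw [h4, toOp_power, ← map_smul, ← Matrix.diagonal_smul]
  congr 2
  funext i
  have hpos := (mem_spd_iff X).1 (mem_spd_of_norm_lt hc h) i
  rw [Pi.smul_apply, smul_eq_mul, ← Real.mul_rpow hc.le (by positivity), mul_inv_cancel_left₀ hc.ne']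

/-- Eigenvectors need not vary smoothly, so the spectral definition is replaced near `X` by an
analytic series between linear maps; `P` brings operators back to symmetric matrices. -/
theorem contDiffAt_power (a : ℝ) {X : Sym d} (hX : X ∈ spd d) : ContDiffAt ℝ ∞ (power a) X := by
  obtain ⟨c, hc, h⟩ := exists_norm_lt hX
  obtain ⟨P, hP⟩ := LinearMap.exists_leftInverse_of_injective (toOp (d := d))
    (LinearMap.ker_eq_bot.2 toOp_injective)
  have hP' : ∀ Y : Sym d, P (toOp Y) = Y := fun Y => LinearMap.congr_fun hP Y
  have hT : ContDiff ℝ ∞ (toOp (d := d)) :=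
    (LinearMap.toContinuousLinearMap (toOp (d := d))).contDiff
  have hPc : ContDiff ℝ ∞ P := (LinearMap.toContinuousLinearMap P).contDiff
  have hsum : ContDiffAt ℝ ∞ (binomialSeries (Op d) a).sum (c⁻¹ • toOp X - 1) := by
    have hr := one_le_radius_binomialSeries (𝔸 := Op d) a
    refine (((binomialSeries (Op d) a).hasFPowerSeriesOnBall
      (one_pos.trans_le hr)).analyticAt_of_mem ?_).contDiffAt
    refine Metric.eball_subset_eball hr ?_
    rw [← ENNReal.ofReal_one, Metric.eball_ofReal]
    simpa using h
  have hmain : ContDiffAt ℝ ∞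
      (fun Y => P (c ^ a • (binomialSeries (Op d) a).sum (c⁻¹ • toOp Y - 1))) X :=
    hPc.contDiffAt.comp X ((hsum.comp X
      (((hT.const_smul c⁻¹).sub contDiff_const).contDiffAt)).const_smul (c ^ a))
  refine hmain.congr_of_eventuallyEq ?_
  filter_upwards [(isOpen_setOf_norm_lt c).mem_nhds h] with Y hY
  rw [← toOp_power_eq_sum a hc hY, hP']

/-! ### Algebra of the matrix power -/

/-- Gives access to the general functional calculus; the spectrum is finite, so continuity
conditions are automatic for every exponent. -/
theorem coe_power (a : ℝ) (X : Sym d) :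
    (power a X : Matrix (Fin d) (Fin d) ℝ) = cfc (fun x : ℝ => x ^ a) X.1 :=
  (X.isHermitian.cfc_eq _).symm

theorem mem_spd_iff_spectrum (X : Sym d) : X ∈ spd d ↔ ∀ x ∈ spectrum ℝ X.1, 0 < x := by
  rw [mem_spd_iff, X.isHermitian.spectrum_real_eq_range_eigenvalues, Set.forall_mem_range]

theorem power_mem (a : ℝ) {X : Sym d} (hX : X ∈ spd d) : power a X ∈ spd d := by
  rw [mem_spd_iff_spectrum] at hX ⊢
  have h : spectrum ℝ (power a X).1 = (fun x : ℝ => x ^ a) '' spectrum ℝ X.1 := by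
    rw [coe_power]
    exact cfc_map_spectrum (fun x : ℝ => x ^ a) X.1 X.2
      (X.1.finite_real_spectrum.continuousOn _)
  rw [h]
  rintro _ ⟨x, hx, rfl⟩
  exact Real.rpow_pos_of_pos (hX x hx) a

theorem power_one (X : Sym d) : power 1 X = X :=
  Subtype.ext <| by
    rw [coe_power]
    simp only [Real.rpow_one]
    exact cfc_id' ℝ X.1 X.2

theorem power_power (a b : ℝ) {X : Sym d} (hX : X ∈ spd d) :
    power a (power b X) = power (b * a) X := by
  rw [mem_spd_iff_spectrum] at hX
  refine Subtype.ext ?_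
  rw [coe_power, coe_power, coe_power]
  refine (cfc_comp' (fun x : ℝ => x ^ a) (fun x : ℝ => x ^ b) X.1
    ((X.1.finite_real_spectrum.image _).continuousOn _)
    (X.1.finite_real_spectrum.continuousOn _) X.2).symm.trans ?_
  exact cfc_congr fun x hx => (Real.rpow_mul (hX x hx).le b a).symm

theorem power_mul_power (a b : ℝ) {X : Sym d} (hX : X ∈ spd d) :
    (power a X : Matrix (Fin d) (Fin d) ℝ) * power b X = power (a + b) X := by
  rw [mem_spd_iff_spectrum] at hX
  rw [coe_power, coe_power, coe_power, ← cfc_mul _ _ X.1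
    (X.1.finite_real_spectrum.continuousOn _) (X.1.finite_real_spectrum.continuousOn _)]
  exact cfc_congr fun x hx => (Real.rpow_add (hX x hx) a b).symm

theorem coe_power_zero (X : Sym d) : (power 0 X : Matrix (Fin d) (Fin d) ℝ) = 1 := by
  rw [coe_power]
  simp only [Real.rpow_zero]
  exact cfc_const_one ℝ X.1 X.2

theorem power_half_mul_self {M : Sym d} (hM : M ∈ spd d) :
    (power (1 / 2) M : Matrix (Fin d) (Fin d) ℝ) * power (1 / 2) M = M := by
  rw [power_mul_power _ _ hM, add_halves, power_one]

theorem power_half_mul_neg {M : Sym d} (hM : M ∈ spd d) :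
    (power (1 / 2) M : Matrix (Fin d) (Fin d) ℝ) * power (-(1 / 2)) M = 1 := by
  rw [power_mul_power _ _ hM, add_neg_cancel, coe_power_zero]

theorem power_neg_mul_half {M : Sym d} (hM : M ∈ spd d) :
    (power (-(1 / 2)) M : Matrix (Fin d) (Fin d) ℝ) * power (1 / 2) M = 1 := by
  rw [power_mul_power _ _ hM, neg_add_cancel, coe_power_zero]

/-! ### Congruences -/

theorem coe_congr (A X : Sym d) : (congr A X : Matrix (Fin d) (Fin d) ℝ) = A.1 * X.1 * A.1 := rfl

theorem congr_congr_of_mul_eq_one {A B : Sym d} (hAB : A.1 * B.1 = 1) (X : Sym d) :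
    congr A (congr B X) = X := by
  refine Subtype.ext ?_
  rw [coe_congr, coe_congr]
  calc A.1 * (B.1 * X.1 * B.1) * A.1 = (A.1 * B.1) * X.1 * (B.1 * A.1) := by noncomm_ring
    _ = X.1 := by rw [hAB, mul_eq_one_comm.1 hAB, one_mul, mul_one]

theorem congr_mem {A : Sym d} (hA : A ∈ spd d) {X : Sym d} (hX : X ∈ spd d) :
    congr A X ∈ spd d := by
  have hA' : Matrix.conjTranspose A.1 = A.1 := A.2
  have := Matrix.PosDef.mul_mul_conjTranspose_same (A := X.1) (B := A.1) hX
    (Matrix.vecMul_injective_of_isUnit hA.isUnit)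
  rwa [hA'] at this

/-- The congruence by `A` as a continuous linear map. -/
noncomputable def congrCLM (A : Sym d) : Sym d →L[ℝ] Sym d :=
  LinearMap.toContinuousLinearMap
    { toFun := congr A
      map_add' := fun X Y => Subtype.ext <| by
        simp only [coe_congr, Submodule.coe_add, mul_add, add_mul]
      map_smul' := fun c X => Subtype.ext <| by simp [coe_congr] }

/-! ### The Lyapunov operator -/

/-- `L ↦ X L + L X`, as a bilinear map. -/
noncomputable def lyapForm : Sym d →ₗ[ℝ] Sym d →ₗ[ℝ] Sym d :=
  LinearMap.mk₂ ℝ (fun X L => ⟨X.1 * L.1 + L.1 * X.1, by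
      have hX : star X.1 = X.1 := X.2
      have hL : star L.1 = L.1 := L.2
      show star _ = _
      rw [star_add, star_mul, star_mul, hX, hL, add_comm]⟩)
    (fun X Y L => Subtype.ext <| by simp only [Submodule.coe_add]; noncomm_ring)
    (fun c X L => Subtype.ext <| by simp)
    (fun X L K => Subtype.ext <| by simp only [Submodule.coe_add]; noncomm_ring)
    (fun c X L => Subtype.ext <| by simp)

theorem coe_lyapForm (X L : Sym d) : (lyapForm X L).1 = X.1 * L.1 + L.1 * X.1 := rfl

/-- If `XL + LX = 0`, multiplying by `L` and taking traces gives `2 tr(LXL) = 0`. As `LXL` is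
positive semidefinite it vanishes, and definiteness of `X` forces every column of `L` to be zero. -/
theorem lyapForm_injective {X : Sym d} (hX : X ∈ spd d) : Function.Injective (lyapForm X) := by
  rw [← LinearMap.ker_eq_bot, LinearMap.ker_eq_bot']
  intro L hL
  have h0 : X.1 * L.1 + L.1 * X.1 = 0 := congrArg Subtype.val hL
  have hLt : L.1.conjTranspose = L.1 := L.2
  have hpsd : (L.1 * X.1 * L.1).PosSemidef := by
    have := Matrix.PosSemidef.mul_mul_conjTranspose_same hX.posSemidef L.1
    rwa [hLt] at this
  have htr : (L.1 * X.1 * L.1).trace = 0 := by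
    have h1 : (L.1 * (X.1 * L.1 + L.1 * X.1)).trace = 0 := by rw [h0]; simp
    rw [mul_add, Matrix.trace_add, ← mul_assoc, Matrix.trace_mul_comm L.1 (L.1 * X.1)] at h1
    linarith
  have hz := hpsd.trace_eq_zero_iff.1 htr
  refine Subtype.ext (Matrix.ext_of_mulVec_single fun j => ?_)
  by_contra hne
  have hpos := hX.dotProduct_mulVec_pos (x := L.1.mulVec (Pi.single j 1)) fun h => hne (h.trans (Matrix.zero_mulVec _).symm)
  have : star (L.1.mulVec (Pi.single j 1)) ⬝ᵥ X.1.mulVec (L.1.mulVec (Pi.single j 1)) =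
      star (Pi.single j 1) ⬝ᵥ (L.1 * X.1 * L.1).mulVec (Pi.single j 1) := by
    rw [Matrix.star_mulVec, hLt, ← Matrix.dotProduct_mulVec, Matrix.mulVec_mulVec,
      Matrix.mulVec_mulVec, mul_assoc]
  rw [this, hz] at hpos
  simp at hpos

/-- The Lyapunov operator, as a continuous linear map depending linearly on the base point. -/
noncomputable def lyapCLM : Sym d →L[ℝ] Sym d →L[ℝ] Sym d := lyapForm.toContinuousBilinearMap

theorem lyapCLM_isInvertible {X : Sym d} (hX : X ∈ spd d) : (lyapCLM X).IsInvertible :=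
  ⟨(LinearEquiv.ofInjectiveEndo (lyapForm X) (lyapForm_injective hX)).toContinuousLinearEquiv, rfl⟩

theorem lyapunov_eq_of {X S L : Sym d} (hX : X ∈ spd d) (h : lyapForm X L = S) :
    lyapunov X S = L := by
  have hex : ∃ L : Sym d, X.1 * L.1 + L.1 * X.1 = S.1 := ⟨L, congrArg Subtype.val h⟩
  have := Classical.epsilon_spec hex
  refine lyapForm_injective hX (Subtype.ext ?_)
  rw [h]
  exact this

/-- In this form, smoothness of operator inversion gives differentiability in `X`. -/
theorem lyapunov_eq_inverse {X : Sym d} (hX : X ∈ spd d) (S : Sym d) :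
    lyapunov X S = (lyapCLM X).inverse S :=
  lyapunov_eq_of hX ((lyapCLM_isInvertible hX).self_apply_inverse S)

theorem lyapForm_lyapunov {X : Sym d} (hX : X ∈ spd d) (S : Sym d) :
    lyapForm X (lyapunov X S) = S := by
  rw [lyapunov_eq_inverse hX]
  exact (lyapCLM_isInvertible hX).self_apply_inverse S

/-- The trace form on symmetric matrices. -/
noncomputable def traceForm : Sym d →L[ℝ] Sym d →L[ℝ] ℝ :=
  (LinearMap.mk₂ ℝ (fun L T : Sym d => (L.1 * T.1).trace)
    (fun X Y L => by simp [add_mul]) (fun c X L => by simp)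
    (fun X L K => by simp [mul_add]) (fun c X L => by simp)).toContinuousBilinearMap

theorem isDiffMetric_bwMetric : RiemChart.IsDiffMetric (spd d) bwMetric where
  exists_form := by
    refine ⟨fun X => (1 / 2 : ℝ) • traceForm.comp (lyapCLM X).inverse, fun X hX => ?_,
      fun X hX S T => ?_⟩
    · have h1 : DifferentiableAt ℝ (fun X : Sym d => (lyapCLM X).inverse) X :=
        (((lyapCLM_isInvertible hX).contDiffAt_map_inverse (n := 1)).differentiableAt
          one_ne_zero).comp X lyapCLM.differentiableAt
      exact ((differentiableAt_const traceForm).clm_comp h1).fun_const_smul (1 / 2 : ℝ)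
    · rw [bwMetric, lyapunov_eq_inverse hX]
      rfl
  symm X hX S T := by
    have hS := congrArg Subtype.val (lyapForm_lyapunov hX S)
    have hT := congrArg Subtype.val (lyapForm_lyapunov hX T)
    rw [coe_lyapForm] at hS hT
    unfold bwMetric
    set L := lyapunov X S
    set K := lyapunov X T
    congr 1
    -- By cyclicity, `tr(L(XK + KX)) = tr(K(XL + LX))`.
    rw [← hS, ← hT, mul_add, mul_add, Matrix.trace_add, Matrix.trace_add, ← mul_assoc, ← mul_assoc,
      ← mul_assoc, ← mul_assoc, Matrix.trace_mul_comm (L.1 * X.1) K.1,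
      Matrix.trace_mul_comm (L.1 * K.1) X.1, ← mul_assoc, ← mul_assoc, add_comm,
      Matrix.trace_mul_comm (X.1 * L.1) K.1, ← mul_assoc, Matrix.trace_mul_comm (K.1 * L.1) X.1,
      ← mul_assoc, add_comm]

/-- The congruence by `A` carries the Bures-Wasserstein metric to the generalised one with
parameter `A²`. -/
theorem gbwMetric_congr {A B M X : Sym d} (hAB : A.1 * B.1 = 1) (hAM : A.1 * A.1 = M.1)
    (hX : X ∈ spd d) (S T : Sym d) :
    gbwMetric M (congr A X) (congr A S) (congr A T) = bwMetric X S T := by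
  have hBA : B.1 * A.1 = 1 := mul_eq_one_comm.1 hAB
  -- With `M = A²` an outer `A` factors out on each side, leaving the ordinary Lyapunov expression
  -- in `ALA`.
  have hexp : ∀ L : Sym d, (congr A X).1 * L.1 * M.1 + M.1 * L.1 * (congr A X).1 =
      (congr A (lyapForm X (congr A L))).1 := fun L => by
    rw [coe_congr A (lyapForm _ _), coe_lyapForm, coe_congr, coe_congr, ← hAM]
    noncomm_ring
  have hex : ∃ L : Sym d, (congr A X).1 * L.1 * M.1 + M.1 * L.1 * (congr A X).1 =
      (congr A S).1 :=
    ⟨congr B (lyapunov X S), by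
      rw [hexp, congr_congr_of_mul_eq_one hAB, lyapForm_lyapunov hX]⟩
  have hspec := Classical.epsilon_spec hex
  change (congr A X).1 * (genLyapunov M (congr A X) (congr A S)).1 * M.1 +
    M.1 * (genLyapunov M (congr A X) (congr A S)).1 * (congr A X).1 = (congr A S).1 at hspec
  rw [hexp] at hspec
  have hL : lyapForm X (congr A (genLyapunov M (congr A X) (congr A S))) = S := by
    rw [← congr_congr_of_mul_eq_one hBA (lyapForm _ _), Subtype.ext hspec,
      congr_congr_of_mul_eq_one hBA]
  rw [gbwMetric, bwMetric, lyapunov_eq_of hX hL, coe_congr A T, coe_congr, ← mul_assoc,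
    Matrix.trace_mul_comm _ A.1]
  simp only [mul_assoc]

/-! ### The isometry onto the power-deformed geometry -/

theorem fMap_mem (θ : ℝ) {M : Sym d} (hM : M ∈ spd d) {X : Sym d} (hX : X ∈ spd d) :
    fMap θ M X ∈ spd d :=
  power_mem _ (congr_mem (power_mem _ hM) hX)

theorem fInv_mem (θ : ℝ) {M : Sym d} (hM : M ∈ spd d) {Y : Sym d} (hY : Y ∈ spd d) :
    fInv θ M Y ∈ spd d :=
  congr_mem (power_mem _ hM) (power_mem _ hY)

theorem power_fMap {θ : ℝ} (hθ : θ ≠ 0) {M : Sym d} (hM : M ∈ spd d) {X : Sym d}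
    (hX : X ∈ spd d) : power θ (fMap θ M X) = congr (power (1 / 2) M) X := by
  rw [fMap, power_power _ _ (congr_mem (power_mem _ hM) hX), one_div_mul_cancel hθ, power_one]

theorem fInv_fMap {θ : ℝ} (hθ : θ ≠ 0) {M : Sym d} (hM : M ∈ spd d) {X : Sym d}
    (hX : X ∈ spd d) : fInv θ M (fMap θ M X) = X := by
  rw [fInv, power_fMap hθ hM hX, congr_congr_of_mul_eq_one (power_neg_mul_half hM)]

theorem fMap_fInv {θ : ℝ} (hθ : θ ≠ 0) {M : Sym d} (hM : M ∈ spd d) {Y : Sym d}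
    (hY : Y ∈ spd d) : fMap θ M (fInv θ M Y) = Y := by
  rw [fMap, fInv, congr_congr_of_mul_eq_one (power_half_mul_neg hM), power_power _ _ hY,
    mul_one_div_cancel hθ, power_one]

theorem contDiffAt_fMap (θ : ℝ) {M : Sym d} (hM : M ∈ spd d) {X : Sym d} (hX : X ∈ spd d) :
    ContDiffAt ℝ ∞ (fMap θ M) X :=
  (contDiffAt_power (1 / θ) (congr_mem (power_mem (1 / 2) hM) hX)).comp X
    (congrCLM (power (1 / 2) M)).contDiff.contDiffAt

theorem contDiffAt_fInv (θ : ℝ) (M : Sym d) {Y : Sym d} (hY : Y ∈ spd d) :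
    ContDiffAt ℝ ∞ (fInv θ M) Y :=
  (congrCLM (power (-(1 / 2)) M)).contDiff.contDiffAt.comp Y (contDiffAt_power θ hY)

/-- The composite is linear near `X`, so no formula for the derivative of a matrix power is needed.
-/
theorem fderiv_power_fMap {θ : ℝ} (hθ : θ ≠ 0) {M : Sym d} (hM : M ∈ spd d) {X : Sym d}
    (hX : X ∈ spd d) (S : Sym d) :
    fderiv ℝ (power θ) (fMap θ M X) (fderiv ℝ (fMap θ M) X S) = congr (power (1 / 2) M) S := by
  have h1 : HasFDerivAt (power θ ∘ fMap θ M)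
      ((fderiv ℝ (power θ) (fMap θ M X)).comp (fderiv ℝ (fMap θ M) X)) X :=
    (((contDiffAt_power θ (fMap_mem θ hM hX)).differentiableAt (by simp)).hasFDerivAt).comp X
      ((contDiffAt_fMap θ hM hX).differentiableAt (by simp)).hasFDerivAt
  have h2 : HasFDerivAt (power θ ∘ fMap θ M) (congrCLM (power (1 / 2) M)) X := by
    refine (congrCLM (power (1 / 2) M)).hasFDerivAt.congr_of_eventuallyEq ?_
    filter_upwards [isOpen_spd.mem_nhds hX] with Y hY using power_fMap hθ hM hY
  exact DFunLike.congr_fun (h1.unique h2) S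

theorem isRiemIsometry_fMap {θ : ℝ} (hθ : θ ≠ 0) {M : Sym d} (hM : M ∈ spd d) :
    RiemChart.IsRiemIsometry (spd d) bwMetric
      (spd d) (fun X S T => θ ^ 2 * powGbwMetric θ M X S T) (fMap θ M) (fInv θ M) where
  mapsTo _ hX := fMap_mem θ hM hX
  mapsTo_inv _ hY := fInv_mem θ hM hY
  invOn := ⟨fun _ hX => fInv_fMap hθ hM hX, fun _ hY => fMap_fInv hθ hM hY⟩
  smooth _ hX := (contDiffAt_fMap θ hM hX).contDiffWithinAt
  smooth_inv _ hY := (contDiffAt_fInv θ M hY).contDiffWithinAt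
  isometry X hX S T := by
    change θ ^ 2 * (1 / θ ^ 2 * gbwMetric M (power θ (fMap θ M X))
      (fderiv ℝ (power θ) (fMap θ M X) (fderiv ℝ (fMap θ M) X S))
      (fderiv ℝ (power θ) (fMap θ M X) (fderiv ℝ (fMap θ M) X T))) = _
    rw [fderiv_power_fMap hθ hM hX, fderiv_power_fMap hθ hM hX,
      power_fMap hθ hM hX, gbwMetric_congr (power_half_mul_neg hM) (power_half_mul_self hM) hX,
      ← mul_assoc, mul_one_div_cancel (pow_ne_zero 2 hθ), one_mul]

/-- The inverse of `f` as an isometry for the metric `c · g^{(θ)}`. -/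
theorem isRiemIsometry_fInv {θ : ℝ} (hθ : θ ≠ 0) {M : Sym d} (hM : M ∈ spd d) (c : ℝ) :
    RiemChart.IsRiemIsometry (spd d) (fun X S T => c * powGbwMetric θ M X S T)
      (spd d) (fun X S T => c / θ ^ 2 * bwMetric X S T) (fInv θ M) (fMap θ M) := by
  have := ((isRiemIsometry_fMap hθ hM).const_mul (c / θ ^ 2)).symm isOpen_spd isOpen_spd
  simpa only [← mul_assoc, div_mul_cancel₀ c (pow_ne_zero 2 hθ)] using this

end SPD

/-! ### Transfer along the isometry and removal of the constant factor -/

theorem theorem3p4 (d : ℕ) (θ : ℝ) (hθ : θ ≠ 0) (M : SPD.Sym d) (hM : M ∈ SPD.spd d) :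
    -- `f` is a Riemannian isometry from the BW metric to `θ²` times the deformed GBW metric
    RiemChart.IsRiemIsometry (SPD.spd d) SPD.bwMetric
      (SPD.spd d) (fun X S T => θ ^ 2 * SPD.powGbwMetric θ M X S T)
      (SPD.fMap θ M) (SPD.fInv θ M) ∧
    -- Fréchet means correspond under `f`
    (∀ (N : ℕ) (w : Fin N → ℝ) (X : Fin N → SPD.Sym d), (∀ i, 0 ≤ w i) → ∑ i, w i = 1 →
      (∀ i, X i ∈ SPD.spd d) →
      RiemChart.frechetMeans (SPD.spd d) (SPD.powGbwMetric θ M) w X =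
        SPD.fMap θ M '' RiemChart.frechetMeans (SPD.spd d) SPD.bwMetric w
          (fun i => SPD.fInv θ M (X i))) ∧
    -- variances differ by the factor `1 / θ²`
    (∀ (N : ℕ) (X : Fin N → SPD.Sym d) (B : SPD.Sym d), (∀ i, X i ∈ SPD.spd d) →
      B ∈ SPD.spd d →
      RiemChart.frechetVar (SPD.spd d) (SPD.powGbwMetric θ M) B X =
        (1 / θ ^ 2) * RiemChart.frechetVar (SPD.spd d) SPD.bwMetric (SPD.fInv θ M B)
          (fun i => SPD.fInv θ M (X i))) ∧
    -- batch normalisation for the metrics `c · g^{(θ)-GBW}`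
    -- (`c = 1`: the deformed GBW metric, `c = θ²`: the metric isometric to the BW metric),
    -- for every reference point `R` on the BW side (the standard choice being `R = I_d`)
    (∀ (c : ℝ), 0 < c → ∀ (N : ℕ) (X : Fin N → SPD.Sym d), (∀ i, X i ∈ SPD.spd d) →
      ∀ G ∈ SPD.spd d, ∀ R ∈ SPD.spd d, ∀ σ : RiemChart.RunStats (SPD.Sym d),
      σ.mean ∈ SPD.spd d → 0 ≤ σ.var → ∀ m ε s : ℝ, 0 ≤ m → m ≤ 1 → 0 < ε → s ≠ 0 →
      -- output in the training phase
      (∀ i, RiemChart.rbnTrain (SPD.spd d) (fun X S T => c * SPD.powGbwMetric θ M X S T) 1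
          (SPD.fMap θ M R) ε s G X i =
        (RiemChart.rbnTrain (SPD.spd d) SPD.bwMetric (c / θ ^ 2) R ε s (SPD.fInv θ M G)
          (fun j => SPD.fInv θ M (X j)) i).map (SPD.fMap θ M)) ∧
      -- update of the running statistics in the training phase
      RiemChart.rbnUpdate (SPD.spd d) (fun X S T => c * SPD.powGbwMetric θ M X S T) 1 m X σ =
        (RiemChart.rbnUpdate (SPD.spd d) SPD.bwMetric (c / θ ^ 2) m
          (fun j => SPD.fInv θ M (X j)) (σ.map (SPD.fInv θ M))).map
            (RiemChart.RunStats.map (SPD.fMap θ M)) ∧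
      -- output in the testing phase
      (∀ i, RiemChart.rbnTest (SPD.spd d) (fun X S T => c * SPD.powGbwMetric θ M X S T)
          (SPD.fMap θ M R) ε s G σ (X i) =
        (RiemChart.rbnTest (SPD.spd d) SPD.bwMetric R ε s (SPD.fInv θ M G)
          (σ.map (SPD.fInv θ M)) (SPD.fInv θ M (X i))).map (SPD.fMap θ M))) := by
  have hU := SPD.isOpen_spd (d := d)
  have hθ2 : 0 < θ ^ 2 := by positivity
  -- With `c = 1` this compares `g^{(θ)}` itself with `θ⁻² g^{BW}`.
  have hiso := SPD.isRiemIsometry_fInv hθ hM 1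
  simp only [one_mul] at hiso
  have h1 : 0 < 1 / θ ^ 2 := by positivity
  refine ⟨SPD.isRiemIsometry_fMap hθ hM, ?_, ?_, ?_⟩
  · intro N w X _ _ hX
    rw [hiso.frechetMeans_eq hU hU w hX, RiemChart.frechetMeans_const_mul h1]
  · intro N X B hX hB
    rw [hiso.frechetVar_eq hU hU hB hX, RiemChart.frechetVar_const_mul h1]
  · intro c hc N X hX G hG R hR σ hσ _ m ε s _ _ _ _
    have hc' : 0 < c / θ ^ 2 := by positivity
    have hf := SPD.isRiemIsometry_fInv hθ hM c
    have hd := SPD.isDiffMetric_bwMetric.const_mul (U := SPD.spd d) (c / θ ^ 2)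
    have hfR := SPD.fMap_mem θ hM hR
    refine ⟨fun i => ?_, ?_, fun i => ?_⟩
    · rw [hf.rbnTrain_eq hU hU hd 1 ε s hfR hG hX, RiemChart.rbnTrain_const_mul hc',
        SPD.fInv_fMap hθ hM hR]
    · rw [hf.rbnUpdate_eq hU hU 1 m hX hσ, RiemChart.rbnUpdate_const_mul hc']
    · rw [hf.rbnTest_eq hU hU hd ε s hfR hG (hX i) hσ, RiemChart.rbnTest_const_mul hc',
        SPD.fInv_fMap hθ hM hR]
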